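/- A subset $B$ of a group $G$ is called a difference basis for a subset $A\subseteq G$ if every $a\in A$ can be written as $a=xy^{-1}$ with $x,y\in B$. For a finite group $G$, the difference size $\Delta[G]$ is the smallest cardinality of a difference basis for $A=G$. For $n\ge 1$ let $C_n=\{z\in\mathbb C: z^n=1\}$ be the cyclic group of order $n$. Corollary. For every prime power $q=p^k$ ($p$ prime, $k\ge 1$) with $q\neq 3$, $$\Delta[C_{q^2-1}]\;\le\; q-1+\frac{12}{\sqrt{73}}\sqrt{q-1}\;<\;q-1+\sqrt{2q-2}.$$ -/

import Mathlib

/-- A subset `B` of a group `G` is a difference basis for a subset `A` of `G` if each `a ∈ A` can be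
written as `a = x * y⁻¹` with `x, y ∈ B`. -/
def IsDifferenceBasis {G : Type*} [Group G] (B A : Set G) : Prop :=
  ∀ a ∈ A, ∃ x ∈ B, ∃ y ∈ B, a = x * y⁻¹

/-- The difference size of `A`: the smallest cardinality of a (finite) difference basis for `A`.
In a finite group such a basis always exists, see `exists_isDifferenceBasis_card_eq`. -/
noncomputable def differenceSize {G : Type*} [Group G] (A : Set G) : ℕ :=
  sInf {n : ℕ | ∃ B : Finset G, IsDifferenceBasis (B : Set G) A ∧ B.card = n}

/-- In a finite group the minimum in the definition of the difference size is attained. -/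
theorem exists_isDifferenceBasis_card_eq {G : Type*} [Group G] [Finite G] (A : Set G) :
    ∃ B : Finset G, IsDifferenceBasis (B : Set G) A ∧ B.card = differenceSize A := by
  have : Fintype G := Fintype.ofFinite G
  have h : {n : ℕ | ∃ B : Finset G, IsDifferenceBasis (B : Set G) A ∧ B.card = n}.Nonempty :=
    ⟨_, Finset.univ, fun a _ => ⟨a, by simp, 1, by simp, by simp⟩, rfl⟩
  exact Nat.sInf_mem h

/-- The cyclic group of order `n`, modelled by the multiplicative group `{z ∈ ℂ : z ^ n = 1}` of
complex `n`-th roots of `1` (used for `n ≥ 1`). -/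
abbrev CyclicGroupC (n : ℕ) : Type := rootsOfUnity n ℂ

/-!
The cyclic group of order `q ^ 2 - 1` is the unit group of the field `K` with `q ^ 2` elements. Let
`F` be the subfield with `q` elements and `θ ∈ K \ F`. By Bose's observation the `q` elements `θ +
a`, `a ∈ F`, have every element of `K \ F` among their quotients (`exists_fixed_mul_add_eq`; the
proof uses the conjugation `x ↦ x ^ q` only). Adding `θ D`, where `D` is a difference basis of the
unit group of `F` with `1 ∈ D`, takes care of `F`; since `θ` is counted twice, the difference size
is at most `q - 1 + |D|` (`differenceSize_cyclicGroupC_sq_sub_one_le`).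

It remains to find a difference basis with at most `12 / √73 * √n` elements in the cyclic group of
order `n = q - 1`. A difference `d` comes with `-d`, so it is enough to have a set of integers
whose differences include `0, …, ⌊n / 2⌋`. Wichmann rulers measure all distances up to `m` with
about `√(3 m)` marks, that is, about `√(3 / 2) * √n` with `3 / 2 < 144 / 73`
(`isCompleteRuler_wichmannRuler_even`). The slack pays for the gaps between the lengths of the
rulers (`exists_isCompleteRuler_card_sq_le_of_le`), and small `n` are treated with explicit rulers.
The bound on `D` cannot be met for `n = 2, 4, 8`. The first of these is the exception `q = 3`, and
for `q = 5, 9` a Wichmann ruler applied to the group of order `q ^ 2 - 1` itself has few enough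
marks.
-/

/-! ### Complete rulers -/

/-- The integer `d` is the difference of two elements of `S`. -/
abbrev IsDifferenceIn (S : Finset ℤ) (d : ℤ) : Prop := ∃ x ∈ S, ∃ y ∈ S, x - y = d

/-- `S` is the set of marks of a ruler that measures every distance `0, 1, …, m`. The marks are
not required to lie in `[0, m]`. -/
def IsCompleteRuler (S : Finset ℤ) (m : ℤ) : Prop :=
  ∀ d, 0 ≤ d → d ≤ m → IsDifferenceIn S d

theorem IsCompleteRuler.mono {S : Finset ℤ} {m n : ℤ} (h : IsCompleteRuler S n) (hmn : m ≤ n) :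
    IsCompleteRuler S m := fun d h0 h1 => h d h0 (h1.trans hmn)

/-- Over natural numbers, completeness is a decidable statement. -/
theorem isCompleteRuler_of_forall_mem_range {S : Finset ℤ} {m : ℕ}
    (h : ∀ d ∈ Finset.range (m + 1), ∃ y ∈ S, y + (d : ℤ) ∈ S) : IsCompleteRuler S m := by
  intro d h0 h1
  lift d to ℕ using h0
  obtain ⟨y, hy, hyd⟩ := h d (Finset.mem_range.2 (by omega))
  exact ⟨_, hyd, y, hy, by ring⟩

/-! ### Wichmann rulers -/

/-- The Wichmann ruler `W(r, s)`: it starts at `0`, and the gaps between consecutive marks are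
`1` (`r` times), `r + 1` (once), `2 r + 1` (`r` times), `4 r + 3` (`s` times),
`2 r + 2` (`r + 1` times), `1` (`r` times). The five sets of the union are the marks up to `r`
and then the marks at the ends of the gaps `r + 1` and `2 r + 1`, `4 r + 3`, `2 r + 2`, and the
final `1`s. Its length is `(2 r + 1) (2 r + 3) + s (4 r + 3)`. -/
def wichmannRuler (r s : ℕ) : Finset ℤ :=
  (Finset.range (r + 1)).image (fun i : ℕ => (i : ℤ)) ∪
  (Finset.range (r + 1)).image (fun i : ℕ => ((i : ℤ) + 1) * (2 * r + 1)) ∪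
  (Finset.range s).image (fun i : ℕ => ((r : ℤ) + 1) * (2 * r + 1) + (i + 1) * (4 * r + 3)) ∪
  (Finset.range (r + 1)).image (fun i : ℕ =>
    ((r : ℤ) + 1) * (2 * r + 1) + s * (4 * r + 3) + (i + 1) * (2 * r + 2)) ∪
  (Finset.range r).image (fun i : ℕ =>
    ((r : ℤ) + 1) * (2 * r + 1) + s * (4 * r + 3) + (r + 1) * (2 * r + 2) + (i + 1))

theorem card_wichmannRuler_le (r s : ℕ) : (wichmannRuler r s).card ≤ 4 * r + s + 3 := by
  unfold wichmannRuler
  refine (Finset.card_union_le _ _).trans ?_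
  have h1 := Finset.card_image_le (s := Finset.range r) (f := fun i : ℕ =>
    ((r : ℤ) + 1) * (2 * r + 1) + s * (4 * r + 3) + (r + 1) * (2 * r + 2) + (i + 1))
  have h2 := Finset.card_image_le (s := Finset.range (r + 1)) (f := fun i : ℕ =>
    ((r : ℤ) + 1) * (2 * r + 1) + s * (4 * r + 3) + (i + 1) * (2 * r + 2))
  have h3 := Finset.card_image_le (s := Finset.range s) (f := fun i : ℕ =>
    ((r : ℤ) + 1) * (2 * r + 1) + (i + 1) * (4 * r + 3))
  have h4 := Finset.card_image_le (s := Finset.range (r + 1)) (f := fun i : ℕ =>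
    ((i : ℤ) + 1) * (2 * r + 1))
  have h5 := Finset.card_image_le (s := Finset.range (r + 1)) (f := fun i : ℕ => (i : ℤ))
  rw [Finset.card_range] at h1 h2 h3 h4 h5
  grw [Finset.card_union_le, Finset.card_union_le, Finset.card_union_le, h1, h2, h3, h4, h5]
  omega

section Marks

variable {r s : ℕ} {i z : ℤ}

theorem mem_wichmannRuler_first (h0 : 0 ≤ i) (h1 : i ≤ r) : i ∈ wichmannRuler r s := by
  lift i to ℕ using h0
  simp only [wichmannRuler, Finset.mem_union, Finset.mem_image, Finset.mem_range]
  exact .inl (.inl (.inl (.inl ⟨i, by omega, rfl⟩)))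

theorem mem_wichmannRuler_second (h0 : 1 ≤ i) (h1 : i ≤ r + 1) (hz : z = i * (2 * r + 1)) :
    z ∈ wichmannRuler r s := by
  obtain ⟨j, rfl⟩ : ∃ j : ℕ, i = j + 1 := ⟨(i - 1).toNat, by omega⟩
  simp only [wichmannRuler, Finset.mem_union, Finset.mem_image, Finset.mem_range]
  exact .inl (.inl (.inl (.inr ⟨j, by omega, hz.symm⟩)))

theorem mem_wichmannRuler_third (h0 : 0 ≤ i) (h1 : i ≤ s)
    (hz : z = (r + 1) * (2 * r + 1) + i * (4 * r + 3)) : z ∈ wichmannRuler r s := by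
  rcases h0.eq_or_lt with rfl | h0
  · exact mem_wichmannRuler_second (i := r + 1) (by omega) le_rfl (by rw [hz]; ring)
  obtain ⟨j, rfl⟩ : ∃ j : ℕ, i = j + 1 := ⟨(i - 1).toNat, by omega⟩
  simp only [wichmannRuler, Finset.mem_union, Finset.mem_image, Finset.mem_range]
  exact .inl (.inl (.inr ⟨j, by omega, hz.symm⟩))

theorem mem_wichmannRuler_fourth (h0 : 0 ≤ i) (h1 : i ≤ r + 1)
    (hz : z = (r + 1) * (2 * r + 1) + s * (4 * r + 3) + i * (2 * r + 2)) :
    z ∈ wichmannRuler r s := by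
  rcases h0.eq_or_lt with rfl | h0
  · exact mem_wichmannRuler_third (i := s) (by omega) le_rfl (by rw [hz]; ring)
  obtain ⟨j, rfl⟩ : ∃ j : ℕ, i = j + 1 := ⟨(i - 1).toNat, by omega⟩
  simp only [wichmannRuler, Finset.mem_union, Finset.mem_image, Finset.mem_range]
  exact .inl (.inr ⟨j, by omega, hz.symm⟩)

theorem mem_wichmannRuler_fifth (h0 : 0 ≤ i) (h1 : i ≤ r)
    (hz : z = (r + 1) * (2 * r + 1) + s * (4 * r + 3) + (r + 1) * (2 * r + 2) + i) :
    z ∈ wichmannRuler r s := by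
  rcases h0.eq_or_lt with rfl | h0
  · exact mem_wichmannRuler_fourth (i := r + 1) (by omega) le_rfl (by rw [hz]; ring)
  obtain ⟨j, rfl⟩ : ∃ j : ℕ, i = j + 1 := ⟨(i - 1).toNat, by omega⟩
  simp only [wichmannRuler, Finset.mem_union, Finset.mem_image, Finset.mem_range]
  exact .inr ⟨j, by omega, hz.symm⟩

end Marks

theorem isCompleteRuler_wichmannRuler_one {s : ℕ} (hs : s ∈ Finset.Icc 1 5) :
    IsCompleteRuler (wichmannRuler 1 s) (15 + 7 * s) := by
  have h : ∀ s ∈ Finset.Icc 1 5, ∀ d ∈ Finset.range (15 + 7 * s + 1),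
    ∃ y ∈ wichmannRuler 1 s, y + (d : ℤ) ∈ wichmannRuler 1 s := by decide +kernel
  exact_mod_cast isCompleteRuler_of_forall_mem_range (h s hs)

/-- The Wichmann rulers with even `r = 2 u` are complete. With `p = 4 r + 3 = 8 u + 3`, a distance
`d = K p + e`, `0 ≤ e < p`, is found as a difference between two of the five groups of marks, and
which two depends on `K` and `e` only. -/
theorem isCompleteRuler_wichmannRuler_even (u s : ℕ) :
    IsCompleteRuler (wichmannRuler (2 * u) s) ((4 * u + 1) * (4 * u + 3) + s * (8 * u + 3)) := by
  intro d hd0 hdL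
  -- Families of differences between the groups of marks. The name `third_first` means a mark of
  -- the third group minus one of the first. A group is extended here by the last mark before it;
  -- `fourth_mid`, `mid_second` pass from the third group to the second or fourth when the shift by
  -- `J` multiples of `8 u + 3` exceeds the length of the third group.
  have second_first : ∀ x i : ℤ, 1 ≤ x → x ≤ 2 * u + 1 → 0 ≤ i → i ≤ 2 * u →
      d = x * (4 * u + 1) - i → IsDifferenceIn (wichmannRuler (2 * u) s) d := by
    intro x i hx hx' hi hi' h
    refine ⟨x * (4 * u + 1), mem_wichmannRuler_second (i := x) hx (by push_cast; omega)
      (by push_cast; ring), i, mem_wichmannRuler_first hi (by push_cast; omega), h.symm⟩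
  have fifth_fourth : ∀ x i : ℤ, 0 ≤ x → x ≤ 2 * u + 1 → 0 ≤ i → i ≤ 2 * u →
      d = x * (4 * u + 2) + i → IsDifferenceIn (wichmannRuler (2 * u) s) d := by
    intro x i hx hx' hi hi' h
    exact ⟨_, mem_wichmannRuler_fifth (i := i) hi (by push_cast; omega) rfl,
      _, mem_wichmannRuler_fourth (i := 2 * u + 1 - x) (by omega) (by push_cast; omega) rfl,
      by rw [h]; push_cast; ring⟩
  have third_first : ∀ j i : ℤ, 0 ≤ j → j ≤ s → 0 ≤ i → i ≤ 2 * u →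
      d = (2 * u + 1) * (4 * u + 1) + j * (8 * u + 3) - i →
      IsDifferenceIn (wichmannRuler (2 * u) s) d := by
    intro j i hj hj' hi hi' h
    exact ⟨_, mem_wichmannRuler_third (i := j) hj hj' rfl,
      i, mem_wichmannRuler_first hi (by push_cast; omega), by rw [h]; push_cast; ring⟩
  have fifth_third : ∀ j i : ℤ, 0 ≤ j → j ≤ s → 0 ≤ i → i ≤ 2 * u →
      d = (2 * u + 1) * (4 * u + 2) + j * (8 * u + 3) + i →
      IsDifferenceIn (wichmannRuler (2 * u) s) d := by
    intro j i hj hj' hi hi' h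
    exact ⟨_, mem_wichmannRuler_fifth (i := i) hi (by push_cast; omega) rfl,
      _, mem_wichmannRuler_third (i := s - j) (by omega) (by omega) rfl,
      by rw [h]; push_cast; ring⟩
  have fourth_first : ∀ x i : ℤ, 0 ≤ x → x ≤ 2 * u + 1 → 0 ≤ i → i ≤ 2 * u →
      d = (2 * u + 1) * (4 * u + 1) + s * (8 * u + 3) + x * (4 * u + 2) - i →
      IsDifferenceIn (wichmannRuler (2 * u) s) d := by
    intro x i hx hx' hi hi' h
    exact ⟨_, mem_wichmannRuler_fourth (i := x) hx (by push_cast; omega) rfl,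
      i, mem_wichmannRuler_first hi (by push_cast; omega), by rw [h]; push_cast; ring⟩
  have fifth_second : ∀ x i : ℤ, 0 ≤ x → x ≤ 2 * u → 0 ≤ i → i ≤ 2 * u →
      d = s * (8 * u + 3) + (2 * u + 1) * (4 * u + 2) + i + x * (4 * u + 1) →
      IsDifferenceIn (wichmannRuler (2 * u) s) d := by
    intro x i hx hx' hi hi' h
    exact ⟨_, mem_wichmannRuler_fifth (i := i) hi (by push_cast; omega) rfl,
      _, mem_wichmannRuler_second (i := 2 * u + 1 - x) (by omega) (by push_cast; omega) rfl,
      by rw [h]; push_cast; ring⟩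
  have fifth_first : ∀ i : ℤ, -(2 * u) ≤ i → i ≤ 2 * u →
      d = (s + 2 * u + 1) * (8 * u + 3) + i → IsDifferenceIn (wichmannRuler (2 * u) s) d := by
    intro i hi hi' h
    rcases le_total 0 i with h0 | h0
    · exact ⟨_, mem_wichmannRuler_fifth (i := i) h0 (by push_cast; omega) rfl,
        0, mem_wichmannRuler_first le_rfl (by positivity), by rw [h]; push_cast; ring⟩
    · exact ⟨_, mem_wichmannRuler_fifth (i := 0) le_rfl (by positivity) rfl,
        -i, mem_wichmannRuler_first (by omega) (by push_cast; omega), by rw [h]; push_cast; ring⟩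
  have fourth_mid : ∀ x J : ℤ, 0 ≤ x → x ≤ 2 * u + 1 → 0 ≤ J → J ≤ s + 2 * u →
      J ≤ s + 2 * u + 1 - x →
      d = J * (8 * u + 3) + x * (4 * u + 2) → IsDifferenceIn (wichmannRuler (2 * u) s) d := by
    intro x J hx hx' hJ hJ' hJ'' h
    rcases le_total J s with h0 | h0
    · exact ⟨_, mem_wichmannRuler_fourth (i := x) hx (by push_cast; omega) rfl,
        _, mem_wichmannRuler_third (i := s - J) (by omega) (by omega) rfl,
        by rw [h]; push_cast; ring⟩
    · exact ⟨_, mem_wichmannRuler_fourth (i := J - s + x) (by omega) (by push_cast; omega) rfl,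
        _, mem_wichmannRuler_second (i := 2 * u + 1 - (J - s)) (by omega) (by push_cast; omega) rfl,
        by rw [h]; push_cast; ring⟩
  have mid_second : ∀ x J : ℤ, 0 ≤ x → x ≤ 2 * u → 0 ≤ J → J ≤ s + 2 * u - x →
      d = J * (8 * u + 3) + x * (4 * u + 1) → IsDifferenceIn (wichmannRuler (2 * u) s) d := by
    intro x J hx hx' hJ hJ' h
    rcases le_total J s with h0 | h0
    · exact ⟨_, mem_wichmannRuler_third (i := J) (by omega) (by omega) rfl,
        _, mem_wichmannRuler_second (i := 2 * u + 1 - x) (by omega) (by push_cast; omega) rfl,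
        by rw [h]; push_cast; ring⟩
    · exact ⟨_, mem_wichmannRuler_fourth (i := J - s) (by omega) (by push_cast; omega) rfl,
        _, mem_wichmannRuler_second (i := 2 * u + 1 - (J - s) - x) (by omega)
          (by push_cast; omega) rfl,
        by rw [h]; push_cast; ring⟩
  obtain ⟨K, e, hK0, he0, hep, hde⟩ : ∃ K e : ℤ, 0 ≤ K ∧ 0 ≤ e ∧ e ≤ 8 * u + 2 ∧
      d = K * (8 * u + 3) + e :=
    ⟨d / (8 * u + 3), d % (8 * u + 3), Int.ediv_nonneg hd0 (by positivity),
      Int.emod_nonneg _ (by positivity),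
      Int.le_of_lt_add_one (by
        have := Int.emod_lt_of_pos d (b := 8 * u + 3) (by positivity)
        omega),
      by rw [mul_comm]; exact (Int.mul_ediv_add_emod d _).symm⟩
  have hKs : K ≤ s + 2 * u + 1 := by
    by_contra! h
    have : (s + 2 * u + 2) * (8 * u + 3) ≤ K * (8 * u + 3 : ℤ) := by gcongr; omega
    nlinarith
  generalize hU : (u : ℤ) = U at *
  have hU0 : 0 ≤ U := by omega
  clear hU
  rcases hKs.eq_or_lt with rfl | hKs
  · exact fifth_first e (by omega) (by nlinarith) hde
  -- In each range of `K` consecutive intervals, each from one family, cover the residues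
  -- `0, …, 8 u + 2`. The residues at the upper end are negative residues for `K + 1`.
  rcases lt_or_ge K U with hlo | hlo
  · by_cases h1 : e ≤ K
    · exact fourth_mid (2 * e) (K - e) (by omega) (by omega) (by omega) (by omega) (by omega)
        (by rw [hde]; ring)
    by_cases h2 : e ≤ K + 2 * U
    · exact fifth_fourth (2 * K) (e - K) (by omega) (by omega) (by omega) (by omega)
        (by rw [hde]; ring)
    by_cases h3 : e ≤ 4 * U + 1 - K
    · exact second_first (2 * K + 1) (4 * U + 1 - K - e) (by omega) (by omega) (by omega)
        (by omega) (by rw [hde]; ring)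
    by_cases h4 : e ≤ 4 * U + 1
    · exact mid_second (2 * (4 * U + 1 - e) + 1) (K - (4 * U + 1 - e)) (by omega) (by omega)
        (by omega) (by omega) (by rw [hde]; ring)
    by_cases h5 : e ≤ 4 * U + 2 + K
    · exact fourth_mid (2 * (e - 4 * U - 2) + 1) (K - (e - 4 * U - 2)) (by omega) (by omega)
        (by omega) (by omega) (by omega) (by rw [hde]; ring)
    by_cases h6 : e ≤ 6 * U + 2 + K
    · exact fifth_fourth (2 * K + 1) (e - K - 4 * U - 2) (by omega) (by omega) (by omega)
        (by omega) (by rw [hde]; ring)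
    by_cases h7 : e ≤ 8 * U + 2 - K
    · exact second_first (2 * K + 2) (8 * U + 2 - K - e) (by omega) (by omega) (by omega)
        (by omega) (by rw [hde]; ring)
    · exact mid_second (2 * (8 * U + 3 - e)) (K + 1 - (8 * U + 3 - e)) (by omega) (by omega)
        (by omega) (by omega) (by rw [hde]; ring)
  rcases le_or_gt K (s + U) with hhi | hhi
  · by_cases h1 : e ≤ U
    · exact fourth_mid (2 * e) (K - e) (by omega) (by omega) (by omega) (by omega) (by omega)
        (by rw [hde]; ring)
    by_cases h2 : e ≤ 3 * U + 1
    · exact third_first (K - U) (3 * U + 1 - e) (by omega) (by omega) (by omega) (by omega)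
        (by rw [hde]; ring)
    by_cases h3 : e ≤ 4 * U + 1
    · exact mid_second (2 * (4 * U + 1 - e) + 1) (K - (4 * U + 1 - e)) (by omega) (by omega)
        (by omega) (by omega) (by rw [hde]; ring)
    by_cases h4 : e ≤ 5 * U + 2
    · exact fourth_mid (2 * (e - 4 * U - 2) + 1) (K - (e - 4 * U - 2)) (by omega) (by omega)
        (by omega) (by omega) (by omega) (by rw [hde]; ring)
    by_cases h5 : e ≤ 7 * U + 2
    · exact fifth_third (K - U) (e - 5 * U - 2) (by omega) (by omega) (by omega) (by omega)
        (by rw [hde]; ring)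
    by_cases h6 : K + 1 ≤ s + 2 * U - (8 * U + 3 - e)
    · exact mid_second (2 * (8 * U + 3 - e)) (K + 1 - (8 * U + 3 - e)) (by omega) (by omega)
        (by omega) (by omega) (by rw [hde]; ring)
    · obtain rfl : K = s + U := by omega
      exact fourth_first 1 (7 * U + 3 - e) (by omega) (by omega) (by omega) (by omega)
        (by rw [hde]; ring)
  obtain ⟨y, rfl⟩ : ∃ y, K = s + U + y := ⟨K - s - U, by ring⟩
  by_cases h1 : e ≤ U + 1 - y ∧ y + e ≤ U + 1
  · exact fourth_mid (2 * e) (s + U + y - e) (by omega) (by omega) (by omega) (by omega)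
      (by omega) (by rw [hde]; ring)
  by_cases h2 : e ≤ 3 * U + 1 - y
  · exact fifth_second (2 * y - 1) (e - (U + 1 - y)) (by omega) (by omega) (by omega) (by omega)
      (by rw [hde]; ring)
  by_cases h3 : e ≤ 3 * U + 1 + y
  · exact fourth_first (2 * y) (3 * U + 1 + y - e) (by omega) (by omega) (by omega) (by omega)
      (by rw [hde]; ring)
  by_cases h4 : e ≤ 4 * U + 1
  · exact mid_second (2 * (4 * U + 1 - e) + 1) (s + U + y - (4 * U + 1 - e)) (by omega) (by omega)
      (by omega) (by omega) (by rw [hde]; ring)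
  by_cases h5 : e ≤ 5 * U + 2 - y
  · exact fourth_mid (2 * (e - 4 * U - 2) + 1) (s + U + y - (e - 4 * U - 2)) (by omega) (by omega)
      (by omega) (by omega) (by omega) (by rw [hde]; ring)
  by_cases h6 : e ≤ 7 * U + 2 - y
  · exact fifth_second (2 * y) (e - (5 * U + 2 - y)) (by omega) (by omega) (by omega) (by omega)
      (by rw [hde]; ring)
  by_cases h7 : e ≤ 7 * U + 3 + y
  · exact fourth_first (2 * y + 1) (7 * U + 3 + y - e) (by omega) (by omega) (by omega) (by omega)
      (by rw [hde]; ring)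
  · exact mid_second (2 * (8 * U + 3 - e)) (s + U + y + 1 - (8 * U + 3 - e)) (by omega)
      (by omega) (by omega) (by omega) (by rw [hde]; ring)

/-- For `48 ≤ m` the even Wichmann rulers have room to spare: asymptotically `√(3 m)` marks
suffice, while `√(288 m / 73)` are permitted. -/
theorem exists_isCompleteRuler_card_sq_le_of_le {m : ℕ} (hm : 48 ≤ m) :
    ∃ r s, IsCompleteRuler (wichmannRuler r s) m ∧ 73 * (wichmannRuler r s).card ^ 2 ≤ 288 * m := by
  -- The choice `u ≈ √(m / 48)` makes `s ≈ 2 r` for `r = 2 u`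
  obtain ⟨u, hu1, hum, hmu⟩ : ∃ u, 1 ≤ u ∧ 48 * u ^ 2 ≤ m ∧ m < 48 * (u + 1) ^ 2 := by
    have h1 := Nat.sqrt_le' (m / 48)
    have h2 := Nat.lt_succ_sqrt' (m / 48)
    refine ⟨Nat.sqrt (m / 48), ?_, by omega, by grind⟩
    rw [Nat.le_sqrt]; omega
  -- the least `s` for which the ruler reaches `m`
  obtain ⟨s, hs, hs'⟩ : ∃ s, m ≤ (4 * u + 1) * (4 * u + 3) + s * (8 * u + 3) ∧
      (4 * u + 1) * (4 * u + 3) + s * (8 * u + 3) ≤ m + 8 * u + 2 := by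
    have hlt : (4 * u + 1) * (4 * u + 3) ≤ m := by nlinarith
    refine ⟨(m - (4 * u + 1) * (4 * u + 3) + 8 * u + 2) / (8 * u + 3), ?_, ?_⟩
    · have := Nat.lt_div_mul_add (a := m - (4 * u + 1) * (4 * u + 3) + 8 * u + 2)
        (b := 8 * u + 3) (by positivity)
      omega
    · have := Nat.div_mul_le_self (m - (4 * u + 1) * (4 * u + 3) + 8 * u + 2) (8 * u + 3)
      omega
  refine ⟨2 * u, s, fun d h0 h1 => isCompleteRuler_wichmannRuler_even u s d h0
    (h1.trans (by exact_mod_cast hs)), ?_⟩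
  have hc := card_wichmannRuler_le (2 * u) s
  generalize (wichmannRuler (2 * u) s).card = k at *
  have hk : k * (8 * u + 3) ≤ m + 48 * u ^ 2 + 40 * u + 8 := by
    have : k * (8 * u + 3) ≤ (4 * (2 * u) + s + 3) * (8 * u + 3) := by gcongr
    nlinarith
  have hk2 : (k * (8 * u + 3)) ^ 2 ≤ (m + 48 * u ^ 2 + 40 * u + 8) ^ 2 := by gcongr
  have key : 73 * (m + 48 * u ^ 2 + 40 * u + 8) ^ 2 ≤ 288 * m * (8 * u + 3) ^ 2 := by
    zify at *
    -- The difference `f` of the two sides is a quadratic polynomial in `m` with leading coefficient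
    -- `-73`, hence concave, and it is nonnegative at the end points of `[48 u², 48 (u + 1)²]`.
    obtain ⟨v, hv⟩ : ∃ v : ℤ, (u : ℤ) = v + 1 := ⟨u - 1, by ring⟩
    obtain ⟨a, ha⟩ : ∃ a : ℤ, a = m - 48 * u ^ 2 := ⟨_, rfl⟩
    obtain ⟨b, hb⟩ : ∃ b : ℤ, b = 48 * (u + 1) ^ 2 - m := ⟨_, rfl⟩
    have hv0 : 0 ≤ v := by omega
    have ha0 : 0 ≤ a := by omega
    have hb0 : 0 ≤ b := by omega
    have hf0 : 0 ≤ 288 * (48 * u ^ 2) * (8 * u + 3) ^ 2 -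
        73 * (48 * u ^ 2 + 48 * u ^ 2 + 40 * u + 8 : ℤ) ^ 2 := by
      rw [hv]; ring_nf; positivity
    have hf1 : 0 ≤ 288 * (48 * (u + 1) ^ 2) * (8 * u + 3) ^ 2 -
        73 * (48 * (u + 1) ^ 2 + 48 * u ^ 2 + 40 * u + 8 : ℤ) ^ 2 := by
      rw [hv]; ring_nf; positivity
    have h0 : 0 ≤ (a + b) * (288 * m * (8 * u + 3) ^ 2 -
        73 * (m + 48 * u ^ 2 + 40 * u + 8) ^ 2) := by
      have h := add_nonneg (add_nonneg (mul_nonneg hb0 hf0) (mul_nonneg ha0 hf1))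
        (mul_nonneg (by norm_num : (0 : ℤ) ≤ 73)
          (mul_nonneg (mul_nonneg ha0 hb0) (add_nonneg ha0 hb0)))
      refine h.trans_eq ?_
      rw [ha, hb]
      ring
    have hab : 0 < a + b := by
      have : a + b = 96 * v + 144 := by rw [ha, hb, hv]; ring
      omega
    linarith [nonneg_of_mul_nonneg_right h0 hab]
  have : 73 * k ^ 2 * (8 * u + 3) ^ 2 ≤ 288 * m * (8 * u + 3) ^ 2 := by
    calc 73 * k ^ 2 * (8 * u + 3) ^ 2 = 73 * (k * (8 * u + 3)) ^ 2 := by ring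
      _ ≤ _ := by gcongr
      _ ≤ _ := key
  exact Nat.le_of_mul_le_mul_right this (by positivity)

theorem isCompleteRuler_wichmannRuler_zero (s : ℕ) :
    IsCompleteRuler (wichmannRuler 0 s) (3 + 3 * s) :=
  (isCompleteRuler_wichmannRuler_even 0 s).mono (by push_cast; omega)

/-- Rulers with at most `12 / √73 * √n` marks that measure all distances up to `n / 2`. For
`n = 2, 4, 8` the bound on the number of marks is too strong; for `n = 32` there is such a ruler,
but it is not a Wichmann ruler. -/
theorem exists_isCompleteRuler_card_sq_le {n : ℕ} (h0 : n ≠ 0) (h2 : n ≠ 2) (h4 : n ≠ 4)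
    (h8 : n ≠ 8) (h32 : n ≠ 32) : ∃ (S : Finset ℤ) (m : ℤ), IsCompleteRuler S m ∧ 0 ∈ S ∧
      (n : ℤ) ≤ 2 * m + 1 ∧ 73 * S.card ^ 2 ≤ 144 * n := by
  by_cases hn : 96 ≤ n
  · obtain ⟨r, s, h, hc⟩ := exists_isCompleteRuler_card_sq_le_of_le (m := n / 2) (by omega)
    exact ⟨_, _, h, mem_wichmannRuler_first le_rfl (by positivity), by omega, by omega⟩
  have zero : ∀ s : ℕ, n ≤ 2 * (3 + 3 * s) + 1 → 73 * (s + 3) ^ 2 ≤ 144 * n →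
    ∃ (S : Finset ℤ) (m : ℤ), IsCompleteRuler S m ∧ 0 ∈ S ∧ (n : ℤ) ≤ 2 * m + 1 ∧
      73 * S.card ^ 2 ≤ 144 * n := fun s hs hc =>
    ⟨_, _, isCompleteRuler_wichmannRuler_zero s, mem_wichmannRuler_first le_rfl (by positivity),
      by omega, by grw [card_wichmannRuler_le, ← hc]; simp⟩
  have one : ∀ s ∈ Finset.Icc 1 5, n ≤ 2 * (15 + 7 * s) + 1 → 73 * (s + 7) ^ 2 ≤ 144 * n →
    ∃ (S : Finset ℤ) (m : ℤ), IsCompleteRuler S m ∧ 0 ∈ S ∧ (n : ℤ) ≤ 2 * m + 1 ∧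
      73 * S.card ^ 2 ≤ 144 * n := fun s hs hs' hc =>
    ⟨_, _, isCompleteRuler_wichmannRuler_one hs, mem_wichmannRuler_first le_rfl (by positivity),
      by omega, by grw [card_wichmannRuler_le, ← hc]; apply le_of_eq; ring⟩
  by_cases h : n ≤ 1
  · exact ⟨{0}, 0, fun d hd hd' => ⟨0, by simp, 0, by simp, by omega⟩, by simp, by omega,
      by simp; omega⟩
  by_cases h : n ≤ 3
  · exact ⟨{0, 1}, 1, fun d hd hd' => ⟨d, by simp; omega, 0, by simp, by omega⟩, by simp,
      by omega, by simp; omega⟩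
  by_cases h : n ≤ 7
  · exact zero 0 (by omega) (by omega)
  by_cases h : n ≤ 13
  · exact zero 1 (by omega) (by omega)
  by_cases h : n ≤ 19
  · exact zero 2 (by omega) (by omega)
  by_cases h : n ≤ 25
  · exact zero 3 (by omega) (by omega)
  by_cases h : n ≤ 31
  · exact zero 4 (by omega) (by omega)
  by_cases h : n ≤ 45
  · exact one 1 (by decide) (by omega) (by omega)
  by_cases h : n ≤ 59
  · exact one 2 (by decide) (by omega) (by omega)
  by_cases h : n ≤ 73
  · exact one 3 (by decide) (by omega) (by omega)
  by_cases h : n ≤ 87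
  · exact one 4 (by decide) (by omega) (by omega)
  · exact one 5 (by decide) (by omega) (by omega)

/-! ### From rulers to difference bases of cyclic groups -/

/-- Modulo `n` every integer is congruent to `± d` with `0 ≤ d ≤ n / 2`, so a ruler of half the
length `n` yields all powers of an element whose order divides `n`. -/
theorem IsCompleteRuler.exists_zpow_eq {G : Type*} [Group G] {g : G} {n : ℕ} (hn : n ≠ 0)
    (hg : g ^ n = 1) {S : Finset ℤ} {m : ℤ} (hS : IsCompleteRuler S m) (hnm : (n : ℤ) ≤ 2 * m + 1)
    (j : ℤ) : ∃ x ∈ S, ∃ y ∈ S, g ^ j = g ^ x * (g ^ y)⁻¹ := by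
  have h0 : 0 ≤ j % n := Int.emod_nonneg _ (by omega)
  have h1 : j % n < n := Int.emod_lt_of_pos _ (by omega)
  have hj : g ^ j = g ^ (j % n) := by
    conv_lhs => rw [← Int.mul_ediv_add_emod j n, zpow_add, zpow_mul, zpow_natCast, hg, one_zpow,
      one_mul]
  by_cases h : j % n ≤ m
  · obtain ⟨x, hx, y, hy, hxy⟩ := hS _ h0 h
    exact ⟨x, hx, y, hy, by rw [hj, ← hxy, zpow_sub]⟩
  · obtain ⟨x, hx, y, hy, hxy⟩ := hS (n - j % n) (by omega) (by omega)
    refine ⟨y, hy, x, hx, ?_⟩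
    have : j % n = y - x + n := by omega
    rw [hj, this, zpow_add, zpow_natCast, hg, mul_one, zpow_sub]

theorem differenceSize_le_card {G H : Type*} [Group G] [Group H] (e : G ≃* H) {B : Finset G}
    (hB : IsDifferenceBasis (B : Set G) Set.univ) :
    differenceSize (Set.univ : Set H) ≤ B.card := by
  classical
  refine le_trans (Nat.sInf_le ⟨B.image e, fun a _ => ?_, rfl⟩) Finset.card_image_le
  obtain ⟨x, hx, y, hy, h⟩ := hB (e.symm a) trivial
  exact ⟨e x, by simpa using hx, e y, by simpa using hy, by
    rw [← map_inv, ← map_mul, ← h, e.apply_symm_apply]⟩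

theorem differenceSize_cyclicGroupC_le_of_isCompleteRuler {n : ℕ} (hn : n ≠ 0) {S : Finset ℤ}
    {m : ℤ} (hS : IsCompleteRuler S m) (hnm : (n : ℤ) ≤ 2 * m + 1) :
    differenceSize (Set.univ : Set (CyclicGroupC n)) ≤ S.card := by
  classical
  have : NeZero n := ⟨hn⟩
  obtain ⟨g, hg⟩ := IsCyclic.exists_generator (α := CyclicGroupC n)
  have hgn : g ^ n = 1 := by
    have := pow_card_eq_one' (x := g)
    rwa [Complex.card_rootsOfUnity] at this
  refine (differenceSize_le_card (MulEquiv.refl _) (B := S.image fun x => g ^ x) ?_).trans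
    Finset.card_image_le
  intro a _
  obtain ⟨j, rfl⟩ := hg a
  obtain ⟨x, hx, y, hy, h⟩ := hS.exists_zpow_eq hn hgn hnm j
  exact ⟨_, by simpa using ⟨x, hx, rfl⟩, _, by simpa using ⟨y, hy, rfl⟩, h⟩

/-! ### Relative difference sets in quadratic extensions -/

/-- Bose's relative difference set: if `σ` is an involution of `K`, then every element outside the
fixed field `F` of `σ` is a quotient `(θ + a) / (θ + b)` with `a, b ∈ F`, whenever `θ ∉ F`
(which makes the denominator nonzero). -/
theorem exists_fixed_mul_add_eq {K : Type*} [Field K] {σ : K →+* K} (hσ : ∀ x, σ (σ x) = x)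
    (θ : K) {u : K} (hu : σ u ≠ u) : ∃ a b, σ a = a ∧ σ b = b ∧ u * (θ + b) = θ + a := by
  have hu' : u - σ u ≠ 0 := sub_ne_zero.2 hu.symm
  have hu'' : σ u - u ≠ 0 := sub_ne_zero.2 hu
  -- the value of `b` that makes `u * (θ + b) - θ` fixed by `σ`
  let b := (σ (u * θ - θ) - (u * θ - θ)) / (u - σ u)
  have hb : σ b = b := by
    simp only [b, map_div₀, map_sub, hσ, map_mul]
    rw [div_eq_div_iff hu'' hu']
    ring
  refine ⟨u * (θ + b) - θ, b, ?_, hb, by ring⟩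
  have : b * (u - σ u) = σ (u * θ - θ) - (u * θ - θ) := div_mul_cancel₀ _ hu'
  simp only [map_sub, map_mul, map_add, hb] at this ⊢
  linear_combination -this

theorem card_filter_pow_eq_self_le {K : Type*} [Field K] [Fintype K] [DecidableEq K] {q : ℕ}
    (hq : 1 < q) : (Finset.univ.filter fun x : K => x ^ q = x).card ≤ q := by
  have hne : (Polynomial.X ^ q - Polynomial.X : Polynomial K) ≠ 0 :=
    FiniteField.X_pow_card_sub_X_ne_zero K hq
  have hdeg : (Polynomial.X ^ q - Polynomial.X : Polynomial K).natDegree = q :=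
    FiniteField.X_pow_card_sub_X_natDegree_eq K hq
  calc _ ≤ (Polynomial.X ^ q - Polynomial.X : Polynomial K).roots.toFinset.card := by
        refine Finset.card_le_card fun x hx => ?_
        simpa [hne, sub_eq_zero] using hx
    _ ≤ _ := Multiset.toFinset_card_le _
    _ ≤ _ := (Polynomial.card_roots' _).trans hdeg.le

/-- A difference basis `D` of the cyclic group of order `q - 1` yields one with at most
`q - 1 + |D|` elements in the cyclic group of order `q ^ 2 - 1`. The latter is the unit group of the
field `K` with `q ^ 2` elements, and for a generator `g` the set `(g + F) ∪ g D` works, `F` being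
the subfield with `q` elements and `D` a difference basis of its unit group. The two parts share
the element `g`, as `D` contains `1`. -/
theorem differenceSize_cyclicGroupC_sq_sub_one_le {q : ℕ} (hq : IsPrimePow q) {S : Finset ℤ}
    {m : ℤ} (hS : IsCompleteRuler S m) (hS0 : 0 ∈ S) (hqm : (q : ℤ) - 1 ≤ 2 * m + 1) :
    differenceSize (Set.univ : Set (CyclicGroupC (q ^ 2 - 1))) + 1 ≤ q + S.card := by
  classical
  have hq2 := hq.two_le
  obtain ⟨p, k, hp, hk, hpk⟩ := (isPrimePow_nat_iff q).1 hq
  have : Fact p.Prime := ⟨hp⟩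
  let K := GaloisField p (k * 2)
  have : Fintype K := Fintype.ofFinite K
  have hK : Nat.card K = q ^ 2 := by rw [GaloisField.card p _ (by omega), pow_mul, hpk]
  let σ : K →+* K := iterateFrobenius K p k
  have hσ : ∀ x, σ x = x ^ q := fun x => by rw [← hpk]; exact iterateFrobenius_def p k x
  have hσσ : ∀ x, σ (σ x) = x := fun x => by
    rw [hσ, hσ, ← pow_mul, ← sq, ← hK, Nat.card_eq_fintype_card, FiniteField.pow_card]
  have hq1 : q ^ 2 - 1 = (q + 1) * (q - 1) := by simpa using Nat.sq_sub_sq q 1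
  have hN : Nat.card Kˣ = q ^ 2 - 1 := by rw [Nat.card_units, hK]
  obtain ⟨g, hg⟩ := IsCyclic.exists_generator (α := Kˣ)
  have hord : orderOf g = (q + 1) * (q - 1) := by
    rw [orderOf_eq_card_of_forall_mem_zpowers hg, hN, hq1]
  have hfix : ∀ u : Kˣ, σ u = u ↔ u ^ (q - 1) = 1 := fun u => by
    rw [hσ, ← Units.val_pow_eq_pow_val, Units.val_inj, ← mul_eq_right (b := u), ← pow_succ,
      Nat.sub_add_cancel (by omega)]
  have hgσ : σ g ≠ g := fun h => by
    have := orderOf_dvd_of_pow_eq_one ((hfix g).1 h)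
    rw [hord] at this
    have := Nat.le_of_dvd (by omega) this
    nlinarith [Nat.sub_add_cancel (show 1 ≤ q by omega)]
  have hne : ∀ a : K, σ a = a → (g : K) + a ≠ 0 := fun a ha h => hgσ <| by
    rw [eq_neg_of_add_eq_zero_left h, map_neg, ha]
  -- the value `1` is never taken, as `g ∉ F`
  let B₁ : Finset Kˣ := (Finset.univ.filter fun x : K => x ^ q = x).image fun a =>
    if h : (g : K) + a ≠ 0 then Units.mk0 _ h else 1
  let B₂ : Finset Kˣ := S.image fun x => g * (g ^ (q + 1)) ^ x
  have mem₁ : ∀ a (ha : σ a = a), Units.mk0 _ (hne a ha) ∈ B₁ := fun a ha =>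
    Finset.mem_image.2 ⟨a, by simpa [← hσ] using ha, dif_pos (hne a ha)⟩
  have hinter : g ∈ B₁ ∩ B₂ := by
    refine Finset.mem_inter.2 ⟨?_, Finset.mem_image.2 ⟨0, hS0, by simp⟩⟩
    convert mem₁ 0 (map_zero σ)
    ext; simp
  have hcard : (B₁ ∪ B₂).card + 1 ≤ q + S.card := by
    have h1 : B₁.card ≤ q := Finset.card_image_le.trans (card_filter_pow_eq_self_le (by omega))
    have h2 : B₂.card ≤ S.card := Finset.card_image_le
    have h3 := Finset.card_union_add_card_inter B₁ B₂
    have h4 : 0 < (B₁ ∩ B₂).card := Finset.card_pos.2 ⟨g, hinter⟩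
    omega
  have : NeZero (q ^ 2 - 1) := ⟨by rw [← hN]; exact Nat.card_pos.ne'⟩
  refine le_trans (Nat.add_le_add_right (differenceSize_le_card
    (mulEquivOfCyclicCardEq (hN.trans (Complex.card_rootsOfUnity _).symm)) (B := B₁ ∪ B₂) ?_) 1)
    hcard
  intro u _
  by_cases hu : σ u = u
  · obtain ⟨i, rfl⟩ := hg u
    have hdvd : ((q + 1 : ℕ) : ℤ) ∣ i := by
      have h := (hfix _).1 hu
      simp only [← zpow_natCast, ← zpow_mul] at h
      have h := orderOf_dvd_iff_zpow_eq_one.2 h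
      rw [hord, Nat.cast_mul] at h
      exact Int.dvd_of_mul_dvd_mul_right (by omega) h
    obtain ⟨j, rfl⟩ := hdvd
    obtain ⟨x, hx, y, hy, h⟩ := hS.exists_zpow_eq (g := g ^ (q + 1)) (n := q - 1) (by omega)
      (by rw [← pow_mul, ← hord, pow_orderOf_eq_one]) (by omega) j
    refine ⟨g * (g ^ (q + 1)) ^ x, ?_, g * (g ^ (q + 1)) ^ y, ?_, ?_⟩
    · exact Finset.mem_coe.2 (Finset.mem_union_right _ (Finset.mem_image_of_mem _ hx))
    · exact Finset.mem_coe.2 (Finset.mem_union_right _ (Finset.mem_image_of_mem _ hy))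
    · rw [mul_inv, mul_mul_mul_comm, mul_inv_cancel, one_mul, ← h, ← zpow_natCast, ← zpow_mul]
  · obtain ⟨a, b, ha, hb, hab⟩ := exists_fixed_mul_add_eq hσσ (g : K) hu
    refine ⟨_, Finset.mem_coe.2 (Finset.mem_union_left _ (mem₁ a ha)),
      _, Finset.mem_coe.2 (Finset.mem_union_left _ (mem₁ b hb)), ?_⟩
    rw [eq_mul_inv_iff_mul_eq]
    ext
    simpa using hab

/-! ### The bound -/

theorem natCast_le_mul_sqrt {c n : ℕ} (h : 73 * c ^ 2 ≤ 144 * n) : (c : ℝ) ≤ 12 / √73 * √n := by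
  have h' : (73 : ℝ) * c ^ 2 ≤ 144 * n := by exact_mod_cast h
  rw [div_mul_eq_mul_div, le_div_iff₀ (by positivity)]
  refine abs_le_of_sq_le_sq' ?_ (by positivity) |>.2
  rw [mul_pow, mul_pow, Real.sq_sqrt (by positivity), Real.sq_sqrt (by positivity)]
  linarith

theorem mainTheorem9 (q : ℕ) (hq : IsPrimePow q) (hq3 : q ≠ 3) :
    (differenceSize (Set.univ : Set (CyclicGroupC (q ^ 2 - 1))) : ℝ)
        ≤ (q : ℝ) - 1 + 12 / √73 * √((q : ℝ) - 1) ∧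
      (q : ℝ) - 1 + 12 / √73 * √((q : ℝ) - 1) < (q : ℝ) - 1 + √(2 * (q : ℝ) - 2) := by
  have hq2 := hq.two_le
  have hcast : (q : ℝ) - 1 = ((q - 1 : ℕ) : ℝ) := by rw [Nat.cast_sub (by omega), Nat.cast_one]
  constructor
  · rw [hcast]
    -- For `q = 5` and `q = 9` no difference basis of the group of order `q - 1` is small enough; a
    -- Wichmann ruler is used directly for the group of order `q ^ 2 - 1`.
    by_cases h5 : q = 5
    · subst h5
      have h1 := (differenceSize_cyclicGroupC_le_of_isCompleteRuler (n := 5 ^ 2 - 1) (by norm_num)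
        (isCompleteRuler_wichmannRuler_zero 3) (by norm_num)).trans (card_wichmannRuler_le 0 3)
      have h2 := natCast_le_mul_sqrt (c := 2) (n := 5 - 1) (by norm_num)
      have h3 : (differenceSize (Set.univ : Set (CyclicGroupC (5 ^ 2 - 1))) : ℝ) ≤ 6 := by
        exact_mod_cast h1
      push_cast at h2 ⊢
      linarith
    by_cases h9 : q = 9
    · subst h9
      have h1 := (differenceSize_cyclicGroupC_le_of_isCompleteRuler (n := 9 ^ 2 - 1) (by norm_num)
        (isCompleteRuler_wichmannRuler_one (s := 4) (by decide)) (by norm_num)).trans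
        (card_wichmannRuler_le 1 4)
      have h2 := natCast_le_mul_sqrt (c := 3) (n := 9 - 1) (by norm_num)
      have h3 : (differenceSize (Set.univ : Set (CyclicGroupC (9 ^ 2 - 1))) : ℝ) ≤ 11 := by
        exact_mod_cast h1
      push_cast at h2 ⊢
      linarith
    have h33 : q ≠ 33 := by
      rintro rfl
      exact absurd hq (by decide +kernel)
    obtain ⟨S, m, hS, hS0, hm, hc⟩ := exists_isCompleteRuler_card_sq_le (n := q - 1) (by omega)
      (by omega) (by omega) (by omega) (by omega)
    have h1 := differenceSize_cyclicGroupC_sq_sub_one_le hq hS hS0 (by omega)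
    have h2 := natCast_le_mul_sqrt hc
    have h3 : (differenceSize (Set.univ : Set (CyclicGroupC (q ^ 2 - 1))) : ℝ) ≤
        ((q - 1 : ℕ) : ℝ) + S.card := by
      rw [← Nat.cast_add, Nat.cast_le]; omega
    linarith
  · have hpos : 0 < √((q : ℝ) - 1) := Real.sqrt_pos.2 (by rw [hcast]; exact_mod_cast (by omega))
    have : 2 * (q : ℝ) - 2 = 2 * (q - 1) := by ring
    rw [this, Real.sqrt_mul zero_le_two]
    gcongr
    rw [div_lt_iff₀ (by positivity), ← Real.sqrt_mul zero_le_two]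
    exact Real.lt_sqrt_of_sq_lt (by norm_num)
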